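/- Let $\mathbb{W} = \{(x,y)\in\mathbb{R}^2 : 0 \le x < y\}$ and $\mathrm{pers}(x,y) = y-x$. A persistence diagram is a pair $D=(S,\mu)$ with $S\subseteq\mathbb{W}$ and $\mu : S\to\{1,2,\dots\}$ such that $\sum_{\mathbf{x}\in S,\ \mathrm{pers}(\mathbf{x})>\epsilon}\mu(\mathbf{x})<\infty$ for every $\epsilon>0$. Write $S_\mu=\{(\mathbf{x},k) : \mathbf{x}\in S,\ 1\le k\le\mu(\mathbf{x})\}$. For $\delta>0$, a $\delta$-matching between $(S,\mu)$ and $(T,\alpha)$ is a bijection between a subset of $S_\mu$ and a subset of $T_\alpha$ such that $\|\mathbf{x}-\mathbf{y}\|_\infty<\delta$ whenever $(\mathbf{x},k)$ is matched with $(\mathbf{y},n)$, and $\mathrm{pers}(\mathbf{z})<2\delta$ for every unmatched element $(\mathbf{z},m)$ of $S_\mu$ or $T_\alpha$. Let $\mathcal{D}$ be the set of all persistence diagrams, with the topology of the bottleneck metric $$d_B(D_1,D_2)=\inf\{\delta>0 : \text{there is a } \delta\text{-matching between } D_1 \text{ and } D_2\}.$$ A topological space $X$ is hemicompact if there is a sequence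 $K_1,K_2,\dots$ of compact subsets of $X$ such that every compact subset of $X$ is contained in some $K_n$. Corollary. The space $\mathcal{D}$ is not hemicompact, and the compact-open topology on the set $C(\mathcal{D},\mathbb{R})$ of continuous functions from $\mathcal{D}$ to $\mathbb{R}$ is not metrizable. -/

import Mathlib

open scoped ENNReal

/-- The wedge `𝕎 = {(x, y) ∈ ℝ² : 0 ≤ x < y}`. -/
def wedge : Set (ℝ × ℝ) := {p | 0 ≤ p.1 ∧ p.1 < p.2}

/-- The persistence `y - x` of a point `(x, y)`. -/
def pers (p : ℝ × ℝ) : ℝ := p.2 - p.1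

/-- The part `𝕎^ε` of the wedge consisting of the points of persistence greater than `ε`. -/
def wedgeAbove (ε : ℝ) : Set (ℝ × ℝ) := {p | p ∈ wedge ∧ ε < pers p}

/-- The multiplicity in `U` of a multiset of points of the plane, given by its multiplicity
function: the sum of the multiplicities of its points in `U`, possibly infinite. -/
noncomputable def multIn (m : ℝ × ℝ → ℕ) (U : Set (ℝ × ℝ)) : ℝ≥0∞ := ∑' x : U, (m x : ℝ≥0∞)

/-- A (possibly infinite) persistence diagram `(S, μ)`: a set `S ⊆ 𝕎` with a multiplicity function
`μ : S → {1, 2, …}`, having finite multiplicity in `𝕎^ε` for each `ε > 0`. The pair is recorded as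
the extension of `μ` by zero to the plane, so that `S` is the support of `mult`. -/
@[ext]
structure PersistenceDiagram where
  mult : ℝ × ℝ → ℕ
  support_subset : Function.support mult ⊆ wedge
  multIn_lt_top : ∀ ε : ℝ, 0 < ε → multIn mult (wedgeAbove ε) < ⊤

namespace PersistenceDiagram

/-- The set `{(x, k) : x ∈ S, 1 ≤ k ≤ μ(x)}` of labelled points of a diagram. -/
def points (D : PersistenceDiagram) : Set ((ℝ × ℝ) × ℕ) := {p | 1 ≤ p.2 ∧ p.2 ≤ D.mult p.1}

/-- A partial matching, i.e. a bijection between a subset of the labelled points of `D` and a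
subset of those of `E`, is a `δ`-matching if matched points are at `ℓ^∞`-distance less than `δ`
(the norm of `ℝ × ℝ` is the maximum norm) and unmatched points of either diagram have
persistence less than `2δ`. -/
def IsMatching {D E : PersistenceDiagram} (δ : ℝ) (M : D.points ≃. E.points) : Prop :=
  (∀ a b, b ∈ M a → ‖a.1.1 - b.1.1‖ < δ) ∧
  (∀ a, M a = none → pers a.1.1 < 2 * δ) ∧
  (∀ b, M.symm b = none → pers b.1.1 < 2 * δ)

/-- The set of `δ > 0` for which there is a `δ`-matching between `D` and `E`. -/
def matchingSet (D E : PersistenceDiagram) : Set ℝ :=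
  {δ | 0 < δ ∧ ∃ M : D.points ≃. E.points, IsMatching δ M}

/-- The bottleneck distance. -/
noncomputable def bottleneckDist (D E : PersistenceDiagram) : ℝ := sInf (matchingSet D E)

theorem mem_wedge_of_mem_points {D : PersistenceDiagram} {p : (ℝ × ℝ) × ℕ} (hp : p ∈ D.points) :
    p.1 ∈ wedge := by
  apply D.support_subset
  have h := hp.1.trans hp.2
  simp only [Function.mem_support]
  omega

theorem finite_inter (D : PersistenceDiagram) {ε : ℝ} (hε : 0 < ε) :
    {x | D.mult x ≠ 0 ∧ ε < pers x}.Finite := by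
  have h := ENNReal.finite_const_le_of_tsum_ne_top (D.multIn_lt_top ε hε).ne one_ne_zero
  refine (h.image Subtype.val).subset ?_
  rintro x ⟨hx, hxε⟩
  refine ⟨⟨x, D.support_subset hx, hxε⟩, ?_, rfl⟩
  simp only [Set.mem_ofPred_eq]
  exact_mod_cast Nat.one_le_iff_ne_zero.mpr hx

theorem exists_pers_lt (D : PersistenceDiagram) :
    ∃ C : ℝ, 0 < C ∧ ∀ p ∈ D.points, pers p.1 < C := by
  obtain ⟨C, hC⟩ := ((D.finite_inter one_pos).image pers).bddAbove
  refine ⟨max C 1 + 1, by positivity, fun p hp => ?_⟩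
  by_cases h : 1 < pers p.1
  · have h0 : D.mult p.1 ≠ 0 := by
      have := hp.1.trans hp.2
      omega
    have := hC ⟨p.1, ⟨h0, h⟩, rfl⟩
    have := le_max_left C 1
    linarith
  · have := le_max_right C 1
    linarith

theorem matchingSet_nonempty (D E : PersistenceDiagram) : (matchingSet D E).Nonempty := by
  obtain ⟨C, hC, hD⟩ := D.exists_pers_lt
  obtain ⟨C', hC', hE⟩ := E.exists_pers_lt
  refine ⟨C + C', by positivity, ⊥, ?_, ?_, ?_⟩
  · intro a b h
    simp at h
  · intro a _
    have := hD a.1 a.2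
    linarith
  · intro b _
    have := hE b.1 b.2
    linarith

theorem bddBelow_matchingSet (D E : PersistenceDiagram) : BddBelow (matchingSet D E) :=
  ⟨0, fun _ h => h.1.le⟩

theorem bottleneckDist_nonneg (D E : PersistenceDiagram) : 0 ≤ bottleneckDist D E :=
  Real.sInf_nonneg fun _ h => h.1.le

theorem pers_le (x y : ℝ × ℝ) : pers x ≤ pers y + 2 * ‖x - y‖ := by
  have h1 := (abs_le.mp (norm_fst_le (x - y))).1
  have h2 := (abs_le.mp (norm_snd_le (x - y))).2
  simp only [Prod.fst_sub, Prod.snd_sub] at h1 h2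
  simp only [pers]
  linarith

theorem IsMatching.symm {D E : PersistenceDiagram} {δ : ℝ} {M : D.points ≃. E.points}
    (h : IsMatching δ M) : IsMatching δ M.symm := by
  refine ⟨fun a b hab => ?_, h.2.2, fun b hb => h.2.1 b (by simpa using hb)⟩
  rw [norm_sub_rev]
  exact h.1 b a (M.mem_iff_mem.mp hab)

theorem IsMatching.trans_aux {D E F : PersistenceDiagram} {δ δ' : ℝ} (hδ' : 0 < δ')
    {M : D.points ≃. E.points} {N : E.points ≃. F.points}
    (h : IsMatching δ M) (h' : IsMatching δ' N) (a : D.points) (ha : (M.trans N) a = none) :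
    pers a.1.1 < 2 * (δ + δ') := by
  rcases hM : M a with _ | b
  · have := h.2.1 a hM
    linarith
  · have hN : N b = none := by
      rw [PEquiv.trans] at ha
      simpa [hM] using ha
    have h1 := h.1 a b hM
    have h2 := h'.2.1 b hN
    have := pers_le a.1.1 b.1.1
    linarith

theorem IsMatching.trans {D E F : PersistenceDiagram} {δ δ' : ℝ} (hδ : 0 < δ) (hδ' : 0 < δ')
    {M : D.points ≃. E.points} {N : E.points ≃. F.points}
    (h : IsMatching δ M) (h' : IsMatching δ' N) : IsMatching (δ + δ') (M.trans N) := by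
  refine ⟨fun a c hac => ?_, h.trans_aux hδ' h', fun c hc => ?_⟩
  · obtain ⟨b, hab, hbc⟩ := (M.mem_trans N a c).mp hac
    have h1 := h.1 a b hab
    have h2 := h'.1 b c hbc
    have := norm_sub_le_norm_sub_add_norm_sub a.1.1 b.1.1 c.1.1
    linarith
  · rw [add_comm]
    exact h'.symm.trans_aux hδ h.symm c (by rwa [PEquiv.symm_trans_rev] at hc)

theorem bottleneckDist_self (D : PersistenceDiagram) : bottleneckDist D D = 0 := by
  refine le_antisymm (le_of_forall_pos_le_add fun ε hε => ?_) (bottleneckDist_nonneg D D)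
  rw [zero_add]
  refine csInf_le (bddBelow_matchingSet D D) ⟨hε, PEquiv.refl _, ?_, ?_, ?_⟩
  · intro a b h
    have : a = b := by simpa using h
    simpa [this] using hε
  · intro a h
    simp at h
  · intro a h
    simp at h

theorem bottleneckDist_le_symm (D E : PersistenceDiagram) :
    bottleneckDist D E ≤ bottleneckDist E D :=
  le_csInf (matchingSet_nonempty E D) fun _ ⟨h, _, hM⟩ =>
    csInf_le (bddBelow_matchingSet D E) ⟨h, _, hM.symm⟩

theorem bottleneckDist_triangle (D E F : PersistenceDiagram) :
    bottleneckDist D F ≤ bottleneckDist D E + bottleneckDist E F := by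
  refine le_of_forall_pos_le_add fun ε hε => ?_
  obtain ⟨δ, ⟨h, M, hM⟩, hlt⟩ := exists_lt_of_csInf_lt (matchingSet_nonempty D E)
    (show bottleneckDist D E < bottleneckDist D E + ε / 2 by linarith)
  obtain ⟨δ', ⟨h', N, hN⟩, hlt'⟩ := exists_lt_of_csInf_lt (matchingSet_nonempty E F)
    (show bottleneckDist E F < bottleneckDist E F + ε / 2 by linarith)
  have := csInf_le (bddBelow_matchingSet D F) ⟨add_pos h h', _, hM.trans h h' hN⟩
  change bottleneckDist D F ≤ _ at this
  linarith

theorem mult_le_of_bottleneckDist_eq_zero {D E : PersistenceDiagram}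
    (h : bottleneckDist D E = 0) (x : ℝ × ℝ) : D.mult x ≤ E.mult x := by
  by_cases hx : D.mult x = 0
  · omega
  have hp : 0 < pers x := sub_pos.mpr (D.support_subset hx).2
  -- the finitely many points of `E` other than `x` of large persistence stay away from `x`
  have hfin : ({y | E.mult y ≠ 0 ∧ pers x / 3 < pers y} \ {x}).Finite :=
    (E.finite_inter (by positivity)).subset Set.sdiff_subset
  obtain ⟨r, hr, hball⟩ := Metric.isOpen_iff.mp hfin.isClosed.isOpen_compl x (by simp)
  obtain ⟨δ, ⟨hδ, M, hM⟩, hlt⟩ := exists_lt_of_csInf_lt (matchingSet_nonempty D E)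
    (show bottleneckDist D E < min r (pers x / 3) by rw [h]; positivity)
  have key : ∀ a : D.points, a.1.1 = x → ∃ b, b ∈ M a ∧ b.1.1 = x := by
    intro a ha
    rcases hMa : M a with _ | b
    · have h1 := hM.2.1 a hMa
      have h2 := min_le_right r (pers x / 3)
      rw [ha] at h1
      linarith
    · refine ⟨b, rfl, ?_⟩
      by_contra hne
      have h1 := hM.1 a b hMa
      rw [ha] at h1
      have h2 := min_le_right r (pers x / 3)
      have h3 := min_le_left r (pers x / 3)
      have h4 := pers_le x b.1.1
      refine hball (show b.1.1 ∈ Metric.ball x r from ?_) ⟨⟨?_, ?_⟩, hne⟩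
      · rw [Metric.mem_ball, dist_comm, dist_eq_norm]
        linarith
      · have := b.2.1.trans b.2.2
        omega
      · linarith
  have hmem : ∀ k : Fin (D.mult x), (x, k.1 + 1) ∈ D.points := fun k =>
    ⟨Nat.succ_le_succ (Nat.zero_le _), k.2⟩
  choose f hf hfx using fun k : Fin (D.mult x) => key ⟨(x, k.1 + 1), hmem k⟩ rfl
  have hbound : ∀ k, 1 ≤ (f k).1.2 ∧ (f k).1.2 ≤ E.mult x := fun k => by
    have := (f k).2
    exact ⟨this.1, hfx k ▸ this.2⟩
  have hinj : Function.Injective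
      (fun k => (⟨(f k).1.2 - 1, by have := hbound k; omega⟩ : Fin (E.mult x))) := by
    intro k l hkl
    have h1 := hbound k
    have h2 := hbound l
    have h3 : (f k).1.2 - 1 = (f l).1.2 - 1 := by simpa using hkl
    have h4 : f k = f l := Subtype.ext (Prod.ext ((hfx k).trans (hfx l).symm) (by omega))
    have h5 := M.inj (hf k) (h4 ▸ hf l)
    have h6 : k.1 + 1 = l.1 + 1 := congrArg (fun a => a.1.2) h5
    exact Fin.ext (by omega)
  simpa using Fintype.card_le_of_injective _ hinj

/-- The space of persistence diagrams with the bottleneck distance; its topology is the metric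
topology of this distance. -/
noncomputable instance : MetricSpace PersistenceDiagram where
  dist := bottleneckDist
  dist_self := bottleneckDist_self
  dist_comm D E := le_antisymm (bottleneckDist_le_symm D E) (bottleneckDist_le_symm E D)
  dist_triangle := bottleneckDist_triangle
  eq_of_dist_eq_zero {D E} h := by
    have h' : bottleneckDist E D = 0 := le_antisymm
      ((bottleneckDist_le_symm E D).trans_eq h) (bottleneckDist_nonneg E D)
    ext x
    exact le_antisymm (mult_le_of_bottleneckDist_eq_zero h x)
      (mult_le_of_bottleneckDist_eq_zero h' x)

end PersistenceDiagram

/-- A topological space is hemicompact if it has a sequence of compact subsets such that every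
compact subset is contained in one of them. (Applied to points, this gives that the sequence
covers the space.) -/
def IsHemicompact (X : Type*) [TopologicalSpace X] : Prop :=
  ∃ K : ℕ → Set X, (∀ n, IsCompact (K n)) ∧ ∀ L : Set X, IsCompact L → ∃ n, L ⊆ K n

open Filter Topology

/-! A hemicompact metric space is locally compact, but the empty diagram has no compact
neighbourhood. Indeed, the diagrams carrying a single point `x` with multiplicity 0, 1, 2, ... all
lie within `pers x` of the empty diagram, yet are pairwise at least `pers x / 2` apart; and `pers x`
can be arbitrarily small. A metrizable compact-open topology would be first countable at zero, which
forces hemicompactness of the domain, so the second claim follows from the first. -/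

theorem IsHemicompact.exists_isCompact_mem_nhds {X : Type*} [PseudoMetricSpace X]
    (h : IsHemicompact X) (x : X) : ∃ K : Set X, IsCompact K ∧ K ∈ 𝓝 x := by
  obtain ⟨K, hK, hsup⟩ := h
  by_contra! hx
  -- Diagonal argument: such points converge to `x`, and together with `x` they form a compact set
  -- contained in no `K n`.
  have key : ∀ n : ℕ, ∃ y, dist y x < 1 / ((n : ℝ) + 1) ∧ y ∉ K n := by
    intro n
    by_contra! hn
    exact hx _ (hK n) (Metric.mem_nhds_iff.mpr ⟨_, Nat.one_div_pos_of_nat, fun y hy => hn y hy⟩)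
  choose u hu hmem using key
  have hlim : Tendsto u atTop (𝓝 x) := tendsto_iff_dist_tendsto_zero.mpr <|
    squeeze_zero (fun _ => dist_nonneg) (fun n => (hu n).le) tendsto_one_div_add_atTop_nhds_zero_nat
  obtain ⟨n, hn⟩ := hsup _ hlim.isCompact_insert_range
  exact hmem n (hn (Set.mem_insert_of_mem _ ⟨n, rfl⟩))

/-- A metric space whose space of real continuous functions is first countable at zero in the
compact-open topology is hemicompact. -/
theorem isHemicompact_of_isCountablyGenerated_nhds_zero {X : Type*} [MetricSpace X]
    [(𝓝 (0 : C(X, ℝ))).IsCountablyGenerated] : IsHemicompact X := by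
  obtain ⟨U, hU⟩ := (𝓝 (0 : C(X, ℝ))).exists_antitone_basis
  have hbasis := nhds_basis_uniformity' (x := (0 : C(X, ℝ)))
    Metric.uniformity_basis_dist.compactConvergenceUniformity
  -- Each `U n` contains all functions smaller than `(p n).2` on the compact set `(p n).1`; these
  -- compact sets are the required sequence.
  choose p hp hpU using fun n => hbasis.mem_iff.mp (hU.mem n)
  refine ⟨fun n => (p n).1, fun n => (hp n).1, fun L hL => ?_⟩
  obtain ⟨n, hn⟩ := hU.mem_iff.mp (hbasis.mem_of_mem (i := (L, 1)) ⟨hL, one_pos⟩)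
  refine ⟨n, fun x hx => ?_⟩
  by_contra hxn
  -- A function vanishing on `(p n).1` lies in `U n`, hence is smaller than 1 on `L`; the value 1 at
  -- `x` contradicts this.
  obtain ⟨f, hf0, hf1, -⟩ := exists_continuous_zero_one_of_isClosed (hp n).1.isClosed
    (isClosed_singleton (x := x)) (Set.disjoint_singleton_right.mpr hxn)
  have hf : f ∈ U n := hpU n fun y hy => by simpa [hf0 hy] using (hp n).2
  have h1 : dist ((0 : C(X, ℝ)) x) (f x) < 1 := hn hf x hx
  simp [hf1 (Set.mem_singleton x)] at h1

namespace PersistenceDiagram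

/-- The diagram consisting of one point of the wedge with multiplicity `n`. -/
noncomputable def single (x : ℝ × ℝ) (hx : x ∈ wedge) (n : ℕ) : PersistenceDiagram where
  mult := Pi.single x n
  support_subset := fun y hy => by
    by_cases h : y = x
    · exact h ▸ hx
    · simp [h] at hy
  multIn_lt_top := fun ε _ => by
    refine lt_of_le_of_lt (ENNReal.tsum_comp_le_tsum_of_injective Subtype.val_injective
      (fun y => ((Pi.single x n : ℝ × ℝ → ℕ) y : ℝ≥0∞))) ?_
    rw [tsum_eq_single x fun y hy => by simp [hy]]
    simp

theorem points_single {x : ℝ × ℝ} (hx : x ∈ wedge) (n : ℕ) :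
    (single x hx n).points = Prod.mk x '' Set.Icc 1 n := by
  ext ⟨y, k⟩
  by_cases h : y = x
  · subst h
    simp [points, single]
  · simp [points, single, h, Ne.symm h]
    omega

theorem pers_of_mem_points_single {x : ℝ × ℝ} {hx : x ∈ wedge} {n : ℕ} {p : (ℝ × ℝ) × ℕ}
    (hp : p ∈ (single x hx n).points) : pers p.1 = pers x := by
  rw [points_single] at hp
  obtain ⟨k, -, rfl⟩ := hp
  rfl

/-- The empty matching suffices for `δ = pers x`, whatever the multiplicities. -/
theorem dist_single_single_le {x : ℝ × ℝ} (hx : x ∈ wedge) (m n : ℕ) :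
    dist (single x hx m) (single x hx n) ≤ pers x := by
  have hpos : 0 < pers x := sub_pos.mpr hx.2
  refine csInf_le (bddBelow_matchingSet _ _) ⟨hpos, ⊥, fun a b h => by simp at h, ?_, ?_⟩ <;>
  · intro a _
    rw [pers_of_mem_points_single a.2]
    linarith

/-- For `δ < pers x / 2` no copy of `x` may stay unmatched, so `n` copies would inject into `m`. -/
theorem le_dist_single_single {x : ℝ × ℝ} (hx : x ∈ wedge) {m n : ℕ} (hmn : m < n) :
    pers x / 2 ≤ dist (single x hx m) (single x hx n) := by
  refine le_csInf (matchingSet_nonempty _ _) fun δ ⟨_, M, hM⟩ => ?_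
  by_contra! hlt
  have key : ∀ b, ∃ a, a ∈ M.symm b := fun b => by
    rcases h : M.symm b with _ | a
    · have := hM.2.2 b h
      rw [pers_of_mem_points_single b.2] at this
      linarith
    · exact ⟨a, rfl⟩
  choose f hf using key
  have hinj : Function.Injective f := fun b c hbc => M.symm.inj (hf b) (hbc ▸ hf c)
  have hcard : ∀ k, Nat.card (single x hx k).points = k := fun k => by
    rw [points_single, Nat.card_image_of_injective (Prod.mk_right_injective x)]
    simp
  have : Finite (single x hx m).points := by
    rw [points_single]
    exact ((Set.finite_Icc 1 m).image _).to_subtype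
  have := Nat.card_le_card_of_injective f hinj
  rw [hcard, hcard] at this
  omega

theorem not_mem_nhds_of_isCompact {K : Set PersistenceDiagram} (hK : IsCompact K)
    {z : ℝ × ℝ} (hz : z ∈ wedge) : K ∉ 𝓝 (single z hz 0) := by
  intro hmem
  obtain ⟨r, hr, hball⟩ := Metric.mem_nhds_iff.mp hmem
  -- Persistence `r / 2` keeps the sequence inside the `r`-ball and makes it `r / 4`-separated.
  have hx : ((0, r / 2) : ℝ × ℝ) ∈ wedge := ⟨le_rfl, half_pos hr⟩
  -- Multiplicity zero gives the empty diagram, whatever the base point.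
  have hzero : single z hz 0 = single (0, r / 2) hx 0 := by
    ext y
    simp [single]
  have hpers : pers (0, r / 2) = r / 2 := sub_zero _
  obtain ⟨D, -, φ, hφ, hlim⟩ := hK.tendsto_subseq (x := single (0, r / 2) hx) fun n => hball <| by
    rw [hzero, Metric.mem_ball]
    have := dist_single_single_le hx n 0
    linarith
  obtain ⟨N, hN⟩ := Metric.cauchySeq_iff'.mp hlim.cauchySeq (r / 4) (by positivity)
  have h1 := hN (N + 1) N.le_succ
  have h2 := le_dist_single_single hx (hφ N.lt_succ_self)
  rw [dist_comm] at h1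
  simp only [Function.comp_apply] at h1
  linarith

theorem not_isHemicompact : ¬ IsHemicompact PersistenceDiagram := fun h => by
  have hx : ((0, 1) : ℝ × ℝ) ∈ wedge := ⟨le_rfl, one_pos⟩
  obtain ⟨K, hK, hmem⟩ := h.exists_isCompact_mem_nhds (single (0, 1) hx 0)
  exact not_mem_nhds_of_isCompact hK hx hmem

end PersistenceDiagram

theorem mainTheorem5 :
    ¬ IsHemicompact PersistenceDiagram ∧
      ¬ TopologicalSpace.MetrizableSpace C(PersistenceDiagram, ℝ) := by
  refine ⟨PersistenceDiagram.not_isHemicompact, fun _ => ?_⟩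
  exact PersistenceDiagram.not_isHemicompact isHemicompact_of_isCountablyGenerated_nhds_zero
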